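/- Let $m\in\mathbb{N}$ and let $D: SO(3)\to U(m)$ be a unitary representation of the rotation group on $\mathbb{C}^m$. Let $H^1(\mathbb{R}^3,\mathbb{C}^m)$ be the Sobolev space of all $u\in L^2(\mathbb{R}^3,\mathbb{C}^m)$ whose weak first partial derivatives belong to $L^2(\mathbb{R}^3,\mathbb{C}^m)$, with the norm $\|u\|_{H^1}=\big(\|u\|_2^2+\sum_{i=1}^3\|\partial_i u\|_2^2\big)^{1/2}$, and let $$H^1_\rho=\{u\in H^1(\mathbb{R}^3,\mathbb{C}^m) : \rho(R)u=u \text{ for all } R\in SO(3)\},\qquad [\rho(R)u](x)=D(R)\,u(R^{-1}x),$$ equipped with the $H^1$-norm. Then: (a) There is a constant $C>0$ such that for all $u\in H^1_\rho$ $$|u(x)|\le \frac{C}{|x|}\,\|u\|_{H^1}\quad\text{for almost all }x\in\mathbb{R}^3.$$ (b) For every $p\in(2,6)$ the space $H^1_\rho$ is compactly embedded in $L^p(\mathbb{R}^3,\mathbb{C}^m)$; that is, every $u\in H^1_\rho$ belongs to $L^p(\mathbb{R}^3,\mathbb{C}^m)$, and the inclusion $H^1_\rho\hookrightarrow L^p(\mathbb{R}^3,\mathbb{C}^m)$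 is an injective, continuous and compact linear operator. -/

import Mathlib

open MeasureTheory
open scoped ENNReal ContDiff

noncomputable section

namespace RotSobolev

/-- `ℝ³` with its Euclidean norm. -/
abbrev R3 : Type := EuclideanSpace ℝ (Fin 3)

/-- `ℂᵐ` with its Hermitian norm. -/
abbrev Cm (m : ℕ) : Type := EuclideanSpace ℂ (Fin m)

/-- `L²(ℝ³, ℂᵐ)` with Lebesgue measure. -/
abbrev L2 (m : ℕ) : Type := Lp (Cm m) 2 (volume : Measure R3)

/-- The rotation group `SO(3)`. -/
abbrev SO3 : Type := Matrix.specialOrthogonalGroup (Fin 3) ℝ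

/-- `g` is the weak `i`-th partial derivative of `u`:
`∫ (∂ᵢφ) u = - ∫ φ g` for every smooth compactly supported `φ`. -/
def IsWeakPartial {m : ℕ} (i : Fin 3) (u g : R3 → Cm m) : Prop :=
  ∀ φ : R3 → ℝ, ContDiff ℝ ∞ φ → HasCompactSupport φ →
    ∫ x, (fderiv ℝ φ x (EuclideanSpace.single i 1)) • u x = - ∫ x, φ x • g x

lemma integrable_testFun_smul {m : ℕ} {φ : R3 → ℝ} (hφ : Continuous φ)
    (hc : HasCompactSupport φ) (u : L2 m) : Integrable (fun x => φ x • u x) volume :=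
  ((Lp.memLp u).locallyIntegrable (by norm_num)).integrable_smul_left_of_hasCompactSupport hφ hc

lemma continuous_partial {φ : R3 → ℝ} (hφ : ContDiff ℝ ∞ φ) (v : R3) :
    Continuous (fun x => fderiv ℝ φ x v) :=
  (hφ.continuous_fderiv (by simp)).clm_apply continuous_const

lemma IsWeakPartial.congr {m : ℕ} {i : Fin 3} {u u' g g' : R3 → Cm m}
    (hu : u =ᵐ[volume] u') (hg : g =ᵐ[volume] g') (h : IsWeakPartial i u g) :
    IsWeakPartial i u' g' := by
  intro φ h1 h2
  rw [← integral_congr_ae (hu.mono fun x hx =>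
      congrArg (fun y => fderiv ℝ φ x (EuclideanSpace.single i 1) • y) hx),
    ← integral_congr_ae (hg.mono fun x hx => congrArg (fun y => φ x • y) hx)]
  exact h φ h1 h2

lemma IsWeakPartial.zero {m : ℕ} (i : Fin 3) : IsWeakPartial i (0 : R3 → Cm m) 0 := by
  intro φ _ _
  simp

lemma IsWeakPartial.add {m : ℕ} {i : Fin 3} {u v g h : L2 m}
    (hu : IsWeakPartial i u g) (hv : IsWeakPartial i v h) :
    IsWeakPartial i (⇑u + ⇑v) (⇑g + ⇑h) := by
  intro φ h1 h2
  have h2' := h2.fderiv_apply (𝕜 := ℝ) (EuclideanSpace.single i (1 : ℝ))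
  have c := continuous_partial h1 (EuclideanSpace.single i (1 : ℝ))
  simp only [Pi.add_apply, smul_add]
  rw [integral_add (integrable_testFun_smul c h2' u) (integrable_testFun_smul c h2' v),
    integral_add (integrable_testFun_smul h1.continuous h2 g)
      (integrable_testFun_smul h1.continuous h2 h), hu φ h1 h2, hv φ h1 h2, neg_add]

lemma IsWeakPartial.smul {m : ℕ} {i : Fin 3} {u g : R3 → Cm m} (c : ℂ)
    (hu : IsWeakPartial i u g) : IsWeakPartial i (c • u) (c • g) := by
  intro φ h1 h2
  simp only [Pi.smul_apply, smul_comm _ c]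
  rw [integral_smul, integral_smul, hu φ h1 h2, smul_neg]

/-- The Hilbert space `H¹(ℝ³, ℂᵐ)`. An element is a function `u ∈ L²` together with its
(uniquely determined) weak partial derivatives `∂₁u, ∂₂u, ∂₃u ∈ L²`. The norm and the inner
product are those of the `ℓ²`-sum of four copies of `L²`, so that
`‖u‖² = ‖u‖₂² + ‖∂₁u‖₂² + ‖∂₂u‖₂² + ‖∂₃u‖₂²`. -/
def H1 (m : ℕ) : Submodule ℂ (WithLp 2 (L2 m × PiLp 2 (fun _ : Fin 3 => L2 m))) where
  carrier := {w | ∀ i : Fin 3, IsWeakPartial i (w.fst) (w.snd i)}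
  zero_mem' := fun i =>
    (IsWeakPartial.zero i).congr (Lp.coeFn_zero _ _ _).symm (Lp.coeFn_zero _ _ _).symm
  add_mem' := fun {a b} ha hb i =>
    ((ha i).add (hb i)).congr (Lp.coeFn_add a.fst b.fst).symm
      (Lp.coeFn_add (a.snd i) (b.snd i)).symm
  smul_mem' := fun c a ha i =>
    ((ha i).smul c).congr (Lp.coeFn_smul c a.fst).symm (Lp.coeFn_smul c (a.snd i)).symm

/-- The inclusion `H¹(ℝ³, ℂᵐ) → L²(ℝ³, ℂᵐ)`: forget the derivatives. -/
def H1.toL2 (m : ℕ) : H1 m →L[ℂ] L2 m :=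
  (WithLp.fstL 2 ℂ (L2 m) (PiLp 2 (fun _ : Fin 3 => L2 m))).comp (H1 m).subtypeL

lemma norm_toEuclideanCLM_rot (R : SO3) (x : R3) :
    ‖Matrix.toEuclideanCLM (𝕜 := ℝ) (R : Matrix (Fin 3) (Fin 3) ℝ) x‖ = ‖x‖ := by
  have h : (R : Matrix (Fin 3) (Fin 3) ℝ).transpose * R = 1 :=
    (Matrix.mem_orthogonalGroup_iff' _ _).1 (Matrix.mem_specialOrthogonalGroup_iff.1 R.2).1
  have h2 : ‖Matrix.toEuclideanCLM (𝕜 := ℝ) (R : Matrix (Fin 3) (Fin 3) ℝ) x‖ ^ 2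
      = ‖x‖ ^ 2 := by
    rw [← real_inner_self_eq_norm_sq,
      Matrix.inner_toEuclideanCLM, Matrix.ofLp_toEuclideanCLM, Matrix.dotProduct_mulVec,
      Matrix.vecMul_mulVec, h, Matrix.vecMul_one]
    rw [EuclideanSpace.real_norm_sq_eq]
    simp [dotProduct, sq]
  exact (sq_eq_sq₀ (norm_nonneg _) (norm_nonneg _)).1 h2

/-- The action `x ↦ R x` of a rotation on `ℝ³`, as an isometry. -/
def rot (R : SO3) : R3 →ₗᵢ[ℝ] R3 where
  toLinearMap := (Matrix.toEuclideanCLM (𝕜 := ℝ) (R : Matrix (Fin 3) (Fin 3) ℝ)).toLinearMap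
  norm_map' := norm_toEuclideanCLM_rot R

lemma measurePreserving_rot (R : SO3) :
    MeasurePreserving (rot R) (volume : Measure R3) (volume : Measure R3) :=
  ((rot R).toLinearIsometryEquiv rfl).measurePreserving

/-- The unitary representation of `SO(3)` on `L²(ℝ³, ℂᵐ)` induced by a unitary representation
`D` on `ℂᵐ`: `[ρ(R) u](x) = D(R) u(R⁻¹ x)`. -/
def rho {m : ℕ} (D : SO3 →* Matrix.unitaryGroup (Fin m) ℂ) (R : SO3) : L2 m →L[ℂ] L2 m :=
  ((Matrix.toEuclideanCLM (𝕜 := ℂ) (D R : Matrix (Fin m) (Fin m) ℂ)).compLpL 2 volume).comp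
    (Lp.compMeasurePreservingₗᵢ ℂ (rot R⁻¹)
      (measurePreserving_rot R⁻¹)).toContinuousLinearMap

/-- The pointwise formula for `ρ(R) u`, almost everywhere. -/
lemma rho_apply_ae {m : ℕ} (D : SO3 →* Matrix.unitaryGroup (Fin m) ℂ) (R : SO3) (u : L2 m) :
    rho D R u =ᵐ[volume] fun x =>
      Matrix.toEuclideanCLM (𝕜 := ℂ) (D R : Matrix (Fin m) (Fin m) ℂ) (u (rot R⁻¹ x)) := by
  refine (ContinuousLinearMap.coeFn_compLpL _ _).trans ?_
  filter_upwards [Lp.coeFn_compMeasurePreserving u (measurePreserving_rot R⁻¹)] with x hx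
  exact congrArg _ hx

/-- The subspace `H¹_ρ` of those `u ∈ H¹(ℝ³, ℂᵐ)` with `ρ(R) u = u` for all `R ∈ SO(3)`,
with the norm of `H¹`. -/
def H1rho {m : ℕ} (D : SO3 →* Matrix.unitaryGroup (Fin m) ℂ) : Submodule ℂ (H1 m) where
  carrier := {u | ∀ R : SO3, rho D R (H1.toL2 m u) = H1.toL2 m u}
  zero_mem' := fun R => by simp
  add_mem' := fun {a b} ha hb R => by rw [map_add, map_add, ha R, hb R]
  smul_mem' := fun c a ha R => by rw [map_smul, map_smul, ha R]

end RotSobolev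

end

/-! Since `D` is unitary, an invariant function has radial modulus, and its values on the ray
through `e0` determine it everywhere. Mollifying with a radial kernel commutes with the action and
does not increase the `L²` norms, so `u` is an a.e. limit of smooth equivariant `v n` whose `L²`
bounds, for function and derivative, are uniform in `n` (`exists_smooth_approx`).

For such a `v`, put `f s = v (s • e0)`. Polar coordinates bound the integrals of `s²‖f‖²` and
`s²‖f'‖²` over the half-line. Two one-dimensional estimates follow. (1) Integrating the derivative
of `‖f‖²` outwards from `s` and using `s² ≤ y²` there gives `s²‖f s‖² ≤ 2b`, which is the decay in
(a). (2) Cauchy–Schwarz against the weight `y²` controls `‖f t - f s‖` by a multiple of `√(s⁻¹ -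
t⁻¹)`. Letting `f t` tend to zero gives a bound by a multiple of `‖x‖^(-1/2)`, whose `p`-th power is
integrable at the origin for `p < 6`. Moreover `f` is uniformly continuous in the variable `1/s`,
which is bounded for `s ≥ r`, so an Arzelà–Ascoli argument gives total boundedness in the sup norm
outside the ball of radius `r`, infinity included.

For (b), a difference `w` is split at radius `r`: inside, the `‖x‖^(-1/2)` bound makes the integral
of `‖w‖^p` small; outside, `‖w‖ ≤ η` gives at most `η^(p-2)‖w‖₂²`, which uses `p > 2`. -/

noncomputable section

namespace RotSobolev

/-! ### Rotations and the radial mollifier -/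

section Mollifier

open Filter Topology Metric

/-- A fixed unit vector of `ℝ³`. -/
def e0 : R3 := EuclideanSpace.single 0 1

lemma norm_e0 : ‖e0‖ = 1 := by simp [e0]

lemma exists_orthogonal_map {x y : R3} (h : ‖x‖ = ‖y‖) :
    ∃ M ∈ Matrix.orthogonalGroup (Fin 3) ℝ, Matrix.toEuclideanCLM (𝕜 := ℝ) M x = y := by
  set f := (ℝ ∙ (x - y))ᗮ.reflection with hf
  refine ⟨Matrix.toEuclideanCLM (𝕜 := ℝ).symm
    (f.toContinuousLinearEquiv : R3 →L[ℝ] R3), ?_, ?_⟩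
  · rw [Matrix.mem_orthogonalGroup_iff', ← Matrix.conjTranspose_eq_transpose_of_trivial,
      ← Matrix.star_eq_conjTranspose]
    refine EquivLike.injective (Matrix.toEuclideanCLM (𝕜 := ℝ) (n := Fin 3)) ?_
    have := (ContinuousLinearMap.norm_map_iff_adjoint_comp_self
      (f.toContinuousLinearEquiv : R3 →L[ℝ] R3)).1 f.norm_map
    rw [map_mul, map_one, map_star, StarAlgEquiv.apply_symm_apply]
    exact this
  · rw [StarAlgEquiv.apply_symm_apply]
    exact Submodule.reflection_sub h

lemma exists_rot (y : R3) : ∃ R : SO3, rot R (‖y‖ • e0) = y := by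
  obtain ⟨M, hM, h⟩ := exists_orthogonal_map (x := ‖y‖ • e0) (y := y) (by simp [norm_smul, norm_e0])
  have hdet : M.det = 1 ∨ M.det = -1 := by
    have := congrArg Matrix.det ((Matrix.mem_orthogonalGroup_iff' _ _).1 hM)
    rw [Matrix.det_mul, Matrix.det_transpose, Matrix.det_one] at this
    exact mul_self_eq_one_iff.1 this
  rcases hdet with hd | hd
  · exact ⟨⟨M, Matrix.mem_specialOrthogonalGroup_iff.2 ⟨hM, hd⟩⟩, h⟩
  -- An orthogonal map of determinant -1 is corrected by a reflection that fixes `e0`.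
  · set N : Matrix (Fin 3) (Fin 3) ℝ := Matrix.diagonal ![1, 1, -1]
    have hN : N ∈ Matrix.orthogonalGroup (Fin 3) ℝ := by
      rw [Matrix.mem_orthogonalGroup_iff',
        Matrix.diagonal_transpose, Matrix.diagonal_mul_diagonal, ← Matrix.diagonal_one]
      congr 1
      ext i
      fin_cases i <;> simp
    refine ⟨⟨M * N, Matrix.mem_specialOrthogonalGroup_iff.2 ⟨mul_mem hM hN, ?_⟩⟩, ?_⟩
    · rw [Matrix.det_mul, hd, Matrix.det_diagonal]
      simp [Fin.prod_univ_three]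
    · have hNe : Matrix.toEuclideanCLM (𝕜 := ℝ) N e0 = e0 := by
        ext i
        rw [Matrix.ofLp_toEuclideanCLM, Matrix.mulVec_diagonal]
        fin_cases i <;> simp [e0]
      change Matrix.toEuclideanCLM (𝕜 := ℝ) (M * N) (‖y‖ • e0) = y
      rw [map_mul, mul_apply_eq_comp, map_smul, hNe]
      exact h

lemma norm_unitary {m : ℕ} (U : Matrix.unitaryGroup (Fin m) ℂ) (z : Cm m) :
    ‖Matrix.toEuclideanCLM (𝕜 := ℂ) (U : Matrix (Fin m) (Fin m) ℂ) z‖ = ‖z‖ := by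
  refine (ContinuousLinearMap.norm_map_iff_adjoint_comp_self _).2 ?_ z
  have := (Matrix.mem_unitaryGroup_iff').1 U.2
  have h2 := congrArg (Matrix.toEuclideanCLM (𝕜 := ℂ) (n := Fin m)) this
  rw [map_mul, map_one, map_star] at h2
  exact h2

/-- Radial smooth bump function, equal to `1` on the ball of radius `δ` and supported in the
ball of radius `2 δ`. -/
def radialBump (δ : ℝ) (x : R3) : ℝ :=
  (ContDiffBumpBase.ofInnerProductSpace R3).toFun 2 (δ⁻¹ • x)

lemma radialBump_congr_norm (δ : ℝ) {x y : R3} (h : ‖x‖ = ‖y‖) :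
    radialBump δ x = radialBump δ y := by
  simp [radialBump, ContDiffBumpBase.ofInnerProductSpace, norm_smul, h]

lemma radialBump_nonneg (δ : ℝ) (x : R3) : 0 ≤ radialBump δ x :=
  (ContDiffBumpBase.mem_Icc _ _ _).1

lemma radialBump_le_one (δ : ℝ) (x : R3) : radialBump δ x ≤ 1 :=
  (ContDiffBumpBase.mem_Icc _ _ _).2

lemma radialBump_eq_one {δ : ℝ} (hδ : 0 < δ) {x : R3} (hx : ‖x‖ ≤ δ) : radialBump δ x = 1 := by
  refine ContDiffBumpBase.eq_one _ 2 one_lt_two _ ?_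
  rw [norm_smul, norm_inv, Real.norm_of_nonneg hδ.le]
  exact (inv_mul_le_one₀ hδ).2 hx

lemma contDiff_radialBump (δ : ℝ) : ContDiff ℝ ∞ (radialBump δ) := by
  rw [← contDiffOn_univ]
  refine (ContDiffBumpBase.smooth (ContDiffBumpBase.ofInnerProductSpace R3)).comp
    (f := fun x : R3 => ((2 : ℝ), δ⁻¹ • x)) (by fun_prop) ?_
  intro x _
  simp

lemma support_radialBump {δ : ℝ} (hδ : 0 < δ) :
    Function.support (radialBump δ) = ball 0 (2 * δ) := by
  ext x
  have h := Set.ext_iff.1 ((ContDiffBumpBase.ofInnerProductSpace R3).support 2 one_lt_two) (δ⁻¹ • x)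
  rw [Function.mem_support] at h ⊢
  refine h.trans ?_
  rw [mem_ball_zero_iff, mem_ball_zero_iff, norm_smul, norm_inv, Real.norm_of_nonneg hδ.le,
    inv_mul_lt_iff₀ hδ, mul_comm]

lemma hasCompactSupport_radialBump {δ : ℝ} (hδ : 0 < δ) : HasCompactSupport (radialBump δ) := by
  rw [HasCompactSupport, tsupport, support_radialBump hδ]
  exact (isBounded_ball).isCompact_closure

lemma integrable_radialBump {δ : ℝ} (hδ : 0 < δ) : Integrable (radialBump δ) volume :=
  (contDiff_radialBump δ).continuous.integrable_of_hasCompactSupport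
    (hasCompactSupport_radialBump hδ)

lemma measure_closedBall_le_integral_radialBump {δ : ℝ} (hδ : 0 < δ) :
    (volume : Measure R3).real (closedBall 0 δ) ≤ ∫ x, radialBump δ x := by
  calc (volume : Measure R3).real (closedBall 0 δ) = ∫ x in closedBall (0 : R3) δ, (1 : ℝ) := by simp
    _ = ∫ x in closedBall (0 : R3) δ, radialBump δ x :=
      setIntegral_congr_fun measurableSet_closedBall fun x hx =>
        (radialBump_eq_one hδ (by simpa using hx)).symm
    _ ≤ ∫ x, radialBump δ x := setIntegral_le_integral (integrable_radialBump hδ)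
        (Eventually.of_forall (radialBump_nonneg δ))

lemma integral_radialBump_pos {δ : ℝ} (hδ : 0 < δ) : 0 < ∫ x, radialBump δ x :=
  lt_of_lt_of_le (ENNReal.toReal_pos (measure_closedBall_pos _ _ hδ).ne'
    measure_closedBall_lt_top.ne) (measure_closedBall_le_integral_radialBump hδ)

/-- Radial mollifier: the bump function normalised to have integral `1`. -/
def mollifier (δ : ℝ) (x : R3) : ℝ := radialBump δ x / ∫ y, radialBump δ y

lemma mollifier_congr_norm (δ : ℝ) {x y : R3} (h : ‖x‖ = ‖y‖) :
    mollifier δ x = mollifier δ y := by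
  rw [mollifier, mollifier, radialBump_congr_norm δ h]

lemma mollifier_nonneg {δ : ℝ} (hδ : 0 < δ) (x : R3) : 0 ≤ mollifier δ x :=
  div_nonneg (radialBump_nonneg δ x) (integral_radialBump_pos hδ).le

lemma contDiff_mollifier (δ : ℝ) : ContDiff ℝ ∞ (mollifier δ) :=
  (contDiff_radialBump δ).div_const _

lemma support_mollifier {δ : ℝ} (hδ : 0 < δ) :
    Function.support (mollifier δ) = ball 0 (2 * δ) := by
  rw [← support_radialBump hδ]
  ext x
  simp [mollifier, (integral_radialBump_pos hδ).ne']

lemma hasCompactSupport_mollifier {δ : ℝ} (hδ : 0 < δ) : HasCompactSupport (mollifier δ) := by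
  rw [HasCompactSupport, tsupport, support_mollifier hδ]
  exact (isBounded_ball).isCompact_closure

lemma integrable_mollifier {δ : ℝ} (hδ : 0 < δ) : Integrable (mollifier δ) volume :=
  (integrable_radialBump hδ).div_const _

lemma integral_mollifier {δ : ℝ} (hδ : 0 < δ) : ∫ x, mollifier δ x = 1 := by
  simp only [mollifier]
  rw [integral_div, div_self (integral_radialBump_pos hδ).ne']

/-- The kernel is at most one over the volume of the ball of radius `δ`, and doubling the radius
multiplies volume by `2³ = 8`. This is the form needed at Lebesgue points. -/
lemma abs_mollifier_le {δ : ℝ} (hδ : 0 < δ) (x₀ x : R3) :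
    |mollifier δ x| ≤ 8 / (volume : Measure R3).real (closedBall x₀ (2 * δ)) := by
  have h8 : (volume : Measure R3).real (closedBall x₀ (2 * δ))
      = 8 * (volume : Measure R3).real (closedBall 0 δ) := by
    rw [Measure.addHaar_real_closedBall _ _ (by positivity),
      Measure.addHaar_real_closedBall _ _ hδ.le, finrank_euclideanSpace, Fintype.card_fin]
    ring
  have hpos : 0 < (volume : Measure R3).real (closedBall 0 δ) :=
    ENNReal.toReal_pos (measure_closedBall_pos _ _ hδ).ne' measure_closedBall_lt_top.ne
  rw [abs_of_nonneg (mollifier_nonneg hδ x), h8, mollifier,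
    div_le_div_iff₀ (integral_radialBump_pos hδ) (by positivity)]
  have := measure_closedBall_le_integral_radialBump hδ
  nlinarith [radialBump_le_one δ x, radialBump_nonneg δ x]

end Mollifier

/-! ### Mollification: derivatives, `L²` bounds, equivariance, a.e. convergence -/

section Mollification

open Filter Topology Metric
open ContinuousLinearMap (lsmul)
open scoped Convolution

/-- Convolution with the radial mollifier. -/
def mollify {m : ℕ} (δ : ℝ) (u : R3 → Cm m) (x : R3) : Cm m := ∫ y, mollifier δ (x - y) • u y

variable {m : ℕ}

lemma mollify_eq_convolution (δ : ℝ) (u : R3 → Cm m) :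
    mollify δ u = mollifier δ ⋆[lsmul ℝ ℝ, volume] u := by
  ext1 x
  rw [convolution_eq_swap]
  rfl

lemma contDiff_mollify {δ : ℝ} (hδ : 0 < δ) {u : R3 → Cm m}
    (hu : LocallyIntegrable u volume) : ContDiff ℝ ∞ (mollify δ u) := by
  rw [mollify_eq_convolution]
  exact (hasCompactSupport_mollifier hδ).contDiff_convolution_left _ (contDiff_mollifier δ) hu

lemma fderiv_mollify_apply {δ : ℝ} (hδ : 0 < δ) {u : R3 → Cm m}
    (hu : LocallyIntegrable u volume) (x v : R3) :
    fderiv ℝ (mollify δ u) x v = ∫ y, fderiv ℝ (mollifier δ) (x - y) v • u y := by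
  have h1 : ContDiff ℝ 1 (mollifier δ) := (contDiff_mollifier δ).of_le (by simp)
  have hc := hasCompactSupport_mollifier hδ
  have hd := hc.hasFDerivAt_convolution_left (lsmul ℝ ℝ) h1 hu x
  rw [mollify_eq_convolution, hd.fderiv, convolution_eq_swap]
  have hex := (hc.fderiv (𝕜 := ℝ)).convolutionExists_left ((lsmul ℝ ℝ).precompL R3)
    (h1.continuous_fderiv (by simp)) hu x
  have hint := hex.integrable_swap
  exact ContinuousLinearMap.integral_apply hint v

/-- The test function is `y ↦ mollifier δ (x - y)`; the sign from the chain rule cancels the one in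
the definition of the weak derivative. -/
lemma IsWeakPartial.fderiv_mollify {i : Fin 3} {u g : R3 → Cm m} (h : IsWeakPartial i u g)
    {δ : ℝ} (hδ : 0 < δ) (hu : LocallyIntegrable u volume) (x : R3) :
    fderiv ℝ (mollify δ u) x (EuclideanSpace.single i 1) = mollify δ g x := by
  rw [fderiv_mollify_apply hδ hu]
  have hφ : ContDiff ℝ ∞ (fun y => mollifier δ (x - y)) :=
    (contDiff_mollifier δ).comp (contDiff_const.sub contDiff_id)
  have hc : HasCompactSupport (fun y => mollifier δ (x - y)) :=
    (hasCompactSupport_mollifier hδ).comp_homeomorph (Homeomorph.subLeft x)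
  have hw := h _ hφ hc
  have hd : ∀ y v, fderiv ℝ (fun y => mollifier δ (x - y)) y v
      = - fderiv ℝ (mollifier δ) (x - y) v := by
    intro y v
    have h1 : HasFDerivAt (mollifier δ) (fderiv ℝ (mollifier δ) (x - y)) (x - y) :=
      (((contDiff_mollifier δ).differentiable (by simp)) _).hasFDerivAt
    have h2 : HasFDerivAt (fun y : R3 => x - y) (-ContinuousLinearMap.id ℝ R3) y :=
      (hasFDerivAt_id y).const_sub x
    have h3 : HasFDerivAt (fun y => mollifier δ (x - y)) _ y := h1.comp y h2
    rw [h3.fderiv]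
    simp
  simp only [hd, neg_smul] at hw
  rw [integral_neg, neg_inj] at hw
  exact hw

lemma lintegral_mollifier_sub_left {δ : ℝ} (hδ : 0 < δ) (x : R3) :
    ∫⁻ y, ‖mollifier δ (x - y)‖ₑ = 1 := by
  rw [lintegral_sub_left_eq_self (fun y => ‖mollifier δ y‖ₑ) x,
    ← ofReal_integral_norm_eq_lintegral_enorm (integrable_mollifier hδ)]
  simp only [Real.norm_of_nonneg (mollifier_nonneg hδ _), integral_mollifier hδ, ENNReal.ofReal_one]

lemma lintegral_mollifier_sub_right {δ : ℝ} (hδ : 0 < δ) (y : R3) :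
    ∫⁻ x, ‖mollifier δ (x - y)‖ₑ = 1 := by
  rw [lintegral_sub_right_eq_self (fun y => ‖mollifier δ y‖ₑ) y,
    ← ofReal_integral_norm_eq_lintegral_enorm (integrable_mollifier hδ)]
  simp only [Real.norm_of_nonneg (mollifier_nonneg hδ _), integral_mollifier hδ, ENNReal.ofReal_one]

/-- Cauchy–Schwarz with the kernel `k` split as `k|u| = k^(1/2) (k|u|²)^(1/2)`, where `k` has mass
one. -/
lemma enorm_mollify_sq_le {δ : ℝ} (hδ : 0 < δ) {u : R3 → Cm m} (hu : AEMeasurable u volume)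
    (x : R3) : ‖mollify δ u x‖ₑ ^ 2 ≤ ∫⁻ y, ‖mollifier δ (x - y)‖ₑ * ‖u y‖ₑ ^ 2 := by
  have hk : AEMeasurable (fun y => ‖mollifier δ (x - y)‖ₑ) volume :=
    (((contDiff_mollifier δ).continuous.comp (continuous_const.sub continuous_id)).enorm).aemeasurable
  have h1 : ‖mollify δ u x‖ₑ ≤ ∫⁻ y, ‖mollifier δ (x - y)‖ₑ * ‖u y‖ₑ := by
    refine (enorm_integral_le_lintegral_enorm _).trans_eq ?_
    simp only [enorm_smul]
  have h2 := ENNReal.lintegral_mul_norm_pow_le (p := 1 / 2) (q := 1 / 2) hk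
    (hk.mul (hu.enorm.pow_const 2)) (by norm_num) (by norm_num) (by norm_num)
  have h3 : ∀ a b : ℝ≥0∞, a ^ (1 / 2 : ℝ) * (a * b ^ 2) ^ (1 / 2 : ℝ) = a * b := by
    intro a b
    rw [← ENNReal.mul_rpow_of_nonneg _ _ (by norm_num), show a * (a * b ^ 2) = (a * b) ^ 2 by ring,
      ← ENNReal.rpow_natCast, ← ENNReal.rpow_mul]
    norm_num
  simp only [Pi.mul_apply, h3, lintegral_mollifier_sub_left hδ, ENNReal.one_rpow, one_mul] at h2
  calc ‖mollify δ u x‖ₑ ^ 2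
      ≤ ((∫⁻ y, ‖mollifier δ (x - y)‖ₑ * ‖u y‖ₑ ^ 2) ^ (1 / 2 : ℝ)) ^ 2 := by
        gcongr
        exact h1.trans h2
    _ = _ := by
        rw [← ENNReal.rpow_natCast, ← ENNReal.rpow_mul]
        norm_num

lemma lintegral_mollify_sq_le {δ : ℝ} (hδ : 0 < δ) {u : R3 → Cm m} (hu : AEMeasurable u volume) :
    ∫⁻ x, ‖mollify δ u x‖ₑ ^ 2 ≤ ∫⁻ y, ‖u y‖ₑ ^ 2 := by
  calc ∫⁻ x, ‖mollify δ u x‖ₑ ^ 2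
      ≤ ∫⁻ x, ∫⁻ y, ‖mollifier δ (x - y)‖ₑ * ‖u y‖ₑ ^ 2 :=
        lintegral_mono fun x => enorm_mollify_sq_le hδ hu x
    _ = ∫⁻ y, ∫⁻ x, ‖mollifier δ (x - y)‖ₑ * ‖u y‖ₑ ^ 2 := by
        have h1 : AEMeasurable (fun z : R3 × R3 => ‖mollifier δ (z.1 - z.2)‖ₑ)
            (volume.prod volume) := (((contDiff_mollifier δ).continuous.comp
            (continuous_fst.sub continuous_snd)).enorm).aemeasurable
        have h2 : AEMeasurable (fun z : R3 × R3 => ‖u z.2‖ₑ ^ 2) (volume.prod volume) :=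
          ((hu.comp_snd).enorm).pow_const 2
        exact lintegral_lintegral_swap (h1.mul h2)
    _ = ∫⁻ y, ‖u y‖ₑ ^ 2 := by
        refine lintegral_congr fun y => ?_
        have h1 : Measurable (fun x : R3 => ‖mollifier δ (x - y)‖ₑ) :=
          (((contDiff_mollifier δ).continuous.comp
            (continuous_id.sub continuous_const)).enorm).measurable
        rw [lintegral_mul_const _ h1, lintegral_mollifier_sub_right hδ y, one_mul]

/-- Substitute `y ↦ R y`: the measure and the radial kernel are invariant, and `D R` comes out of
the integral. -/
lemma mollify_rot {D : SO3 →* Matrix.unitaryGroup (Fin m) ℂ} {u : L2 m}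
    (hu : ∀ R, rho D R u = u) (δ : ℝ) (R : SO3) (x : R3) :
    mollify δ u (rot R x)
      = Matrix.toEuclideanCLM (𝕜 := ℂ) (D R : Matrix (Fin m) (Fin m) ℂ) (mollify δ u x) := by
  have hinv : ∀ y, rot R⁻¹ (rot R y) = y := by
    intro y
    change Matrix.toEuclideanCLM (𝕜 := ℝ) ((R⁻¹ : SO3) : Matrix (Fin 3) (Fin 3) ℝ)
      (Matrix.toEuclideanCLM (𝕜 := ℝ) (R : Matrix (Fin 3) (Fin 3) ℝ) y) = y
    rw [← mul_apply_eq_comp, ← map_mul, ← Submonoid.coe_mul, inv_mul_cancel]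
    simp
  have hae : ∀ᵐ y, u (rot R y)
      = Matrix.toEuclideanCLM (𝕜 := ℂ) (D R : Matrix (Fin m) (Fin m) ℂ) (u y) := by
    have h1 := rho_apply_ae D R u
    rw [hu R] at h1
    have h2 := (measurePreserving_rot R).quasiMeasurePreserving.ae h1
    filter_upwards [h2] with y hy
    rw [hy, hinv]
  have hemb : MeasurableEmbedding (rot R) :=
    ((rot R).toLinearIsometryEquiv rfl).toHomeomorph.measurableEmbedding
  rw [mollify, ← (measurePreserving_rot R).integral_comp hemb, mollify]
  set A := Matrix.toEuclideanCLM (𝕜 := ℂ) (D R : Matrix (Fin m) (Fin m) ℂ) with hA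
  let U : Cm m →ₗᵢ[ℂ] Cm m := ⟨A.toLinearMap, norm_unitary (D R)⟩
  let U' : Cm m ≃L[ℂ] Cm m := (U.toLinearIsometryEquiv rfl).toContinuousLinearEquiv
  have : ∀ y : Cm m, A y = U' y := fun _ => rfl
  -- For an invertible linear map, the exchange with the integral requires no integrability.
  rw [this, ← ContinuousLinearEquiv.integral_comp_comm]
  refine integral_congr_ae ?_
  filter_upwards [hae] with y hy
  rw [hy, ← map_sub, mollifier_congr_norm δ ((rot R).norm_map (x - y)), ← this]
  exact (map_real_smul A A.continuous _ _).symm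

lemma ae_tendsto_mollify {ι : Type*} {l : Filter ι} {δ : ι → ℝ} (hδ : ∀ i, 0 < δ i)
    (hl : Tendsto δ l (𝓝 0)) {u : R3 → Cm m} (hu : LocallyIntegrable u volume) :
    ∀ᵐ x, Tendsto (fun i => mollify (δ i) u x) l (𝓝 (u x)) := by
  filter_upwards [(Besicovitch.vitaliFamily (volume : Measure R3)).ae_tendsto_average_norm_sub hu]
    with x₀ h₀
  have hδ' : Tendsto (fun i => 2 * δ i) l (𝓝[>] 0) :=
    tendsto_nhdsWithin_iff.2 ⟨by simpa using hl.const_mul 2,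
      Eventually.of_forall fun i => mul_pos two_pos (hδ i)⟩
  have := (h₀.comp (Besicovitch.tendsto_filterAt volume x₀)).comp hδ'
  refine tendsto_integral_smul_of_tendsto_average_norm_sub 8 this
    (Eventually.of_forall fun i => hu.integrableOn_isCompact (isCompact_closedBall _ _)) ?_ ?_
    (Eventually.of_forall fun i x => abs_mollifier_le (hδ i) x₀ _)
  · refine tendsto_const_nhds.congr fun i => ?_
    rw [integral_sub_left_eq_self, integral_mollifier (hδ i)]
  · refine Eventually.of_forall fun i x hx => ?_
    have h : x₀ - x ∈ Function.support (mollifier (δ i)) := hx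
    rw [support_mollifier (hδ i), mem_ball_zero_iff] at h
    rw [mem_closedBall, dist_eq_norm_sub']
    exact h.le

/-- Continuously differentiable functions that are equivariant under a representation of `SO(3)`
and, together with their derivative, bounded by `a` in `L²`. -/
structure IsSmoothEquivariant (D : SO3 →* Matrix.unitaryGroup (Fin m) ℂ) (a : ℝ)
    (v : R3 → Cm m) : Prop where
  contDiff : ContDiff ℝ 1 v
  map_rot : ∀ R x, v (rot R x)
    = Matrix.toEuclideanCLM (𝕜 := ℂ) (D R : Matrix (Fin m) (Fin m) ℂ) (v x)
  lintegral_le : ∫⁻ x, ‖v x‖ₑ ^ 2 ≤ ENNReal.ofReal (a ^ 2)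
  lintegral_fderiv_le : ∫⁻ x, ‖fderiv ℝ v x‖ₑ ^ 2 ≤ ENNReal.ofReal (a ^ 2)

lemma lintegral_enorm_sq_eq (u : L2 m) : ∫⁻ x, ‖u x‖ₑ ^ 2 = ENNReal.ofReal (‖u‖ ^ 2) := by
  have h := eLpNorm_nnreal_pow_eq_lintegral (f := u) (μ := volume) (p := 2) two_ne_zero
  have h2 : ‖u‖ₑ = eLpNorm u 2 volume := by rw [Lp.enorm_def]
  rw [ENNReal.ofReal_pow (norm_nonneg _), ofReal_norm, h2]
  simpa using h.symm

/-- The operator norm is at most the Hilbert–Schmidt norm. -/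
lemma enorm_clm_sq_le (L : R3 →L[ℝ] Cm m) :
    ‖L‖ₑ ^ 2 ≤ ∑ i : Fin 3, ‖L (EuclideanSpace.single i 1)‖ₑ ^ 2 := by
  have hL : ‖L‖ ≤ √(∑ i : Fin 3, ‖L (EuclideanSpace.single i 1)‖ ^ 2) := by
    refine L.opNorm_le_bound (Real.sqrt_nonneg _) fun y => ?_
    have hy : L y = ∑ i : Fin 3, y i • L (EuclideanSpace.single i 1) := by
      conv_lhs => rw [← (EuclideanSpace.basisFun (Fin 3) ℝ).sum_repr y, map_sum]
      simp
    calc ‖L y‖ ≤ ∑ i : Fin 3, ‖L (EuclideanSpace.single i 1)‖ * ‖y i‖ := by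
          rw [hy]
          refine (norm_sum_le _ _).trans_eq (Finset.sum_congr rfl fun i _ => ?_)
          rw [norm_smul, mul_comm]
      _ ≤ √(∑ i : Fin 3, ‖L (EuclideanSpace.single i 1)‖ ^ 2) * √(∑ i : Fin 3, ‖y i‖ ^ 2) :=
          Real.sum_mul_le_sqrt_mul_sqrt _ _ _
      _ = _ := by rw [EuclideanSpace.norm_eq]
  have h2 : ‖L‖ ^ 2 ≤ ∑ i : Fin 3, ‖L (EuclideanSpace.single i 1)‖ ^ 2 :=
    (Real.le_sqrt (norm_nonneg _) (by positivity)).1 hL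
  have h3 := ENNReal.ofReal_le_ofReal h2
  rw [ENNReal.ofReal_sum_of_nonneg (fun _ _ => by positivity)] at h3
  simpa only [ENNReal.ofReal_pow (norm_nonneg _), ofReal_norm] using h3

lemma exists_smooth_approx {D : SO3 →* Matrix.unitaryGroup (Fin m) ℂ} (u : H1rho D) :
    ∃ v : ℕ → R3 → Cm m, (∀ n, IsSmoothEquivariant D ‖u‖ (v n)) ∧
      ∀ᵐ x, Tendsto (fun n => v n x) atTop (𝓝 (H1.toL2 m u x)) := by
  set w := H1.toL2 m u with hw
  let g : Fin 3 → L2 m := fun i => (u : WithLp 2 (L2 m × PiLp 2 (fun _ : Fin 3 => L2 m))).snd i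
  have hg : ∀ i, IsWeakPartial i w (g i) := fun i => u.1.2 i
  have hloc : ∀ f : L2 m, LocallyIntegrable f volume :=
    fun f => (Lp.memLp f).locallyIntegrable (by norm_num)
  have hnorm : ‖u‖ ^ 2 = ‖w‖ ^ 2 + ∑ i, ‖g i‖ ^ 2 := by
    have h1 := WithLp.prod_norm_sq_eq_of_L2
      (u : WithLp 2 (L2 m × PiLp 2 (fun _ : Fin 3 => L2 m)))
    rw [PiLp.norm_sq_eq_of_L2] at h1
    exact h1
  let δ : ℕ → ℝ := fun n => 1 / ((n : ℝ) + 1)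
  have hδ : ∀ n, 0 < δ n := fun n => by positivity
  refine ⟨fun n => mollify (δ n) w, fun n => ⟨?_, ?_, ?_, ?_⟩,
    ae_tendsto_mollify hδ tendsto_one_div_add_atTop_nhds_zero_nat (hloc w)⟩
  · exact (contDiff_mollify (hδ n) (hloc w)).of_le (by simp)
  · exact fun R x => mollify_rot u.2 (δ n) R x
  · refine (lintegral_mollify_sq_le (hδ n) (Lp.aestronglyMeasurable w).aemeasurable).trans ?_
    rw [lintegral_enorm_sq_eq]
    refine ENNReal.ofReal_le_ofReal ?_
    rw [hnorm]
    exact le_add_of_nonneg_right (by positivity)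
  · calc ∫⁻ x, ‖fderiv ℝ (mollify (δ n) w) x‖ₑ ^ 2
        ≤ ∫⁻ x, ∑ i, ‖mollify (δ n) (g i) x‖ₑ ^ 2 := by
          refine lintegral_mono fun x => (enorm_clm_sq_le _).trans_eq ?_
          simp only [(hg _).fderiv_mollify (hδ n) (hloc w)]
      _ = ∑ i, ∫⁻ x, ‖mollify (δ n) (g i) x‖ₑ ^ 2 := by
          refine lintegral_finsetSum _ fun i _ => ?_
          exact ((contDiff_mollify (hδ n) (hloc (g i))).continuous.enorm.measurable).pow_const 2
      _ ≤ ∑ i, ENNReal.ofReal (‖g i‖ ^ 2) := by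
          refine Finset.sum_le_sum fun i _ => ?_
          rw [← lintegral_enorm_sq_eq]
          exact lintegral_mollify_sq_le (hδ n) (Lp.aestronglyMeasurable (g i)).aemeasurable
      _ = ENNReal.ofReal (∑ i, ‖g i‖ ^ 2) :=
          (ENNReal.ofReal_sum_of_nonneg fun _ _ => by positivity).symm
      _ ≤ ENNReal.ofReal (‖u‖ ^ 2) := by
          refine ENNReal.ofReal_le_ofReal ?_
          rw [hnorm]
          exact le_add_of_nonneg_left (by positivity)

end Mollification

/-! ### Weighted estimates along a ray and the radial bound -/

section Radial

open Filter Topology Metric Set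

section Curve

variable {E : Type*} [NormedAddCommGroup E] {f f' : ℝ → E} {b s t : ℝ}

lemma intervalIntegral_le_of_integrableOn_Ioi {F : ℝ → ℝ} (hF : ∀ y, 0 ≤ F y)
    (hi : IntegrableOn F (Ioi 0)) (hb : ∫ y in Ioi 0, F y ≤ b) (hs : 0 ≤ s) (hst : s ≤ t) :
    ∫ y in s..t, F y ≤ b := by
  rw [intervalIntegral.integral_of_le hst]
  exact (setIntegral_mono_set hi (Eventually.of_forall hF)
    (Eventually.of_forall fun y hy => lt_of_le_of_lt hs hy.1)).trans hb

/-- Otherwise the integrand would exceed the positive constant `s²ε²` on a half-line of infinite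
length. -/
lemma exists_norm_le_of_integrableOn (hi : IntegrableOn (fun y => y ^ 2 * ‖f y‖ ^ 2) (Ioi 0))
    (hs : 0 < s) {ε : ℝ} (hε : 0 < ε) : ∃ t, s ≤ t ∧ ‖f t‖ ≤ ε := by
  by_contra! h
  have h1 : IntegrableOn (fun _ : ℝ => s ^ 2 * ε ^ 2) (Ioi s) := by
    refine Integrable.mono' (hi.mono_set (Ioi_subset_Ioi hs.le))
      aestronglyMeasurable_const ?_
    filter_upwards [ae_restrict_mem measurableSet_Ioi] with y hy
    rw [Real.norm_of_nonneg (by positivity)]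
    have := h y (le_of_lt hy)
    have hy' : s ≤ y := le_of_lt hy
    gcongr
  rw [integrableOn_const_iff (by finiteness)] at h1
  rcases h1 with h1 | h1
  · have : 0 < s ^ 2 * ε ^ 2 := by positivity
    exact this.ne' (enorm_eq_zero.1 h1)
  · simp at h1

variable [NormedSpace ℝ E] [CompleteSpace E]

/-- Cauchy–Schwarz in its additive form `2‖f'‖ ≤ c y²‖f'‖² + 1/(c y²)`; the parameter `c` is left
free and tuned at each use. -/
lemma norm_sub_le_of_weighted_deriv (hd : ∀ y, HasDerivAt f (f' y) y) (hc : Continuous f')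
    (hi : IntegrableOn (fun y => y ^ 2 * ‖f' y‖ ^ 2) (Ioi 0))
    (hb : ∫ y in Ioi 0, y ^ 2 * ‖f' y‖ ^ 2 ≤ b) (hs : 0 < s) (hst : s ≤ t) {c : ℝ} (hc0 : 0 < c) :
    ‖f t - f s‖ ≤ (c * b + (s⁻¹ - t⁻¹) / c) / 2 := by
  rw [← intervalIntegral.integral_eq_sub_of_hasDerivAt (fun y _ => hd y)
    (hc.intervalIntegrable _ _)]
  have hne : ∀ y ∈ uIcc s t, y ^ 2 ≠ 0 := by
    intro y hy
    rw [uIcc_of_le hst] at hy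
    exact pow_ne_zero 2 (hs.trans_le hy.1).ne'
  have hci : ContinuousOn (fun y : ℝ => (y ^ 2)⁻¹) (uIcc s t) :=
    (continuous_pow 2).continuousOn.inv₀ hne
  have hI1 : IntervalIntegrable (fun y => y ^ 2 * ‖f' y‖ ^ 2) volume s t :=
    (by fun_prop : Continuous fun y => y ^ 2 * ‖f' y‖ ^ 2).intervalIntegrable _ _
  have hinv : ∫ y in s..t, (y ^ 2)⁻¹ = s⁻¹ - t⁻¹ := by
    have := intervalIntegral.integral_eq_sub_of_hasDerivAt (f := fun y : ℝ => -y⁻¹)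
      (f' := fun y => (y ^ 2)⁻¹) (a := s) (b := t) (fun y hy => by
        rw [uIcc_of_le hst] at hy
        simpa using (hasDerivAt_inv (hs.trans_le hy.1).ne').fun_neg) hci.intervalIntegrable
    rw [this]
    ring
  calc ‖∫ y in s..t, f' y‖ ≤ ∫ y in s..t, ‖f' y‖ :=
        intervalIntegral.norm_integral_le_integral_norm hst
    _ ≤ ∫ y in s..t, (c * (y ^ 2 * ‖f' y‖ ^ 2) + (y ^ 2)⁻¹ / c) / 2 := by
        refine intervalIntegral.integral_mono_on hst (hc.norm.intervalIntegrable _ _)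
          (((hI1.const_mul c).add (hci.intervalIntegrable.div_const c)).div_const 2) ?_
        intro y hy
        have hy0 : 0 < y := hs.trans_le hy.1
        have h0 : c * (y ^ 2 * ‖f' y‖ ^ 2) + (y ^ 2)⁻¹ / c - 2 * ‖f' y‖
            = (c * y ^ 2 * ‖f' y‖ - 1) ^ 2 / (c * y ^ 2) := by
          field_simp
          ring
        have h1 : 0 ≤ (c * y ^ 2 * ‖f' y‖ - 1) ^ 2 / (c * y ^ 2) := by positivity
        linarith
    _ = (c * (∫ y in s..t, y ^ 2 * ‖f' y‖ ^ 2) + (s⁻¹ - t⁻¹) / c) / 2 := by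
        rw [intervalIntegral.integral_div, intervalIntegral.integral_add (hI1.const_mul c)
          (hci.intervalIntegrable.div_const c), intervalIntegral.integral_const_mul,
          intervalIntegral.integral_div, hinv]
    _ ≤ _ := by
        have := intervalIntegral_le_of_integrableOn_Ioi (fun y => by positivity) hi hb hs.le hst
        gcongr

lemma norm_le_of_weighted_deriv (hd : ∀ y, HasDerivAt f (f' y) y) (hc : Continuous f')
    (hi : IntegrableOn (fun y => y ^ 2 * ‖f' y‖ ^ 2) (Ioi 0))
    (hb : ∫ y in Ioi 0, y ^ 2 * ‖f' y‖ ^ 2 ≤ b)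
    (hi0 : IntegrableOn (fun y => y ^ 2 * ‖f y‖ ^ 2) (Ioi 0)) (hs : 0 < s) :
    ‖f s‖ ≤ (b + 1) / 2 * (√s)⁻¹ := by
  refine le_of_forall_pos_le_add fun ε hε => ?_
  obtain ⟨t, hst, ht⟩ := exists_norm_le_of_integrableOn hi0 hs hε
  have hsq : 0 < (√s)⁻¹ := inv_pos.2 (Real.sqrt_pos.2 hs)
  -- The choice `c = 1/√s` makes both terms multiples of `1/√s`.
  have h1 := norm_sub_le_of_weighted_deriv hd hc hi hb hs hst hsq
  have h2 : (s⁻¹ - t⁻¹) / (√s)⁻¹ ≤ (√s)⁻¹ := by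
    rw [div_le_iff₀ hsq, ← mul_inv, Real.mul_self_sqrt hs.le]
    have : 0 < t⁻¹ := inv_pos.2 (hs.trans_le hst)
    linarith
  have h3 : ‖f s‖ ≤ ‖f t‖ + ‖f t - f s‖ := by
    rw [norm_sub_rev]
    exact norm_le_norm_add_norm_sub' _ _
  linarith

/-- The derivative of `‖f‖²` is at most `‖f‖² + ‖f'‖²` in absolute value, and `s² ≤ y²` lets the
weight go under the integral. The bound is linear in `b`, as the homogeneous estimate in (a)
requires. -/
lemma sq_mul_norm_sq_le_of_weighted {E : Type*} [NormedAddCommGroup E] [InnerProductSpace ℝ E]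
    {f f' : ℝ → E}
    (hd : ∀ y, HasDerivAt f (f' y) y) (hc : Continuous f')
    (hi : IntegrableOn (fun y => y ^ 2 * ‖f' y‖ ^ 2) (Ioi 0))
    (hb : ∫ y in Ioi 0, y ^ 2 * ‖f' y‖ ^ 2 ≤ b)
    (hi0 : IntegrableOn (fun y => y ^ 2 * ‖f y‖ ^ 2) (Ioi 0))
    (hb0 : ∫ y in Ioi 0, y ^ 2 * ‖f y‖ ^ 2 ≤ b) (hs : 0 < s) :
    s ^ 2 * ‖f s‖ ^ 2 ≤ 2 * b := by
  have hf : Continuous f := continuous_iff_continuousAt.2 fun y => (hd y).continuousAt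
  refine le_of_forall_pos_le_add fun ε hε => ?_
  obtain ⟨t, hst, ht⟩ := exists_norm_le_of_integrableOn hi0 hs
    (div_pos (Real.sqrt_pos.2 hε) hs)
  have hcin : Continuous fun y => 2 * inner ℝ (f y) (f' y) := by fun_prop
  have hI : ‖f t‖ ^ 2 - ‖f s‖ ^ 2 = ∫ y in s..t, 2 * inner ℝ (f y) (f' y) :=
    (intervalIntegral.integral_eq_sub_of_hasDerivAt (fun y _ => (hd y).norm_sq)
      (hcin.intervalIntegrable _ _)).symm
  have hle : s ^ 2 * -(∫ y in s..t, 2 * inner ℝ (f y) (f' y)) ≤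
      (∫ y in s..t, y ^ 2 * ‖f y‖ ^ 2) + ∫ y in s..t, y ^ 2 * ‖f' y‖ ^ 2 := by
    rw [← intervalIntegral.integral_neg, ← intervalIntegral.integral_const_mul,
      ← intervalIntegral.integral_add (Continuous.intervalIntegrable (by fun_prop) _ _)
        (Continuous.intervalIntegrable (by fun_prop) _ _)]
    refine intervalIntegral.integral_mono_on hst (Continuous.intervalIntegrable (by fun_prop) _ _)
      (Continuous.intervalIntegrable (by fun_prop) _ _) fun y hy => ?_
    have h1 := abs_real_inner_le_norm (f y) (f' y)
    have h2 := neg_abs_le (inner ℝ (f y) (f' y))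
    have h3 : -(2 * inner ℝ (f y) (f' y)) ≤ ‖f y‖ ^ 2 + ‖f' y‖ ^ 2 := by
      nlinarith [sq_nonneg (‖f y‖ - ‖f' y‖)]
    have h4 : s ^ 2 ≤ y ^ 2 := pow_le_pow_left₀ hs.le hy.1 2
    calc s ^ 2 * -(2 * inner ℝ (f y) (f' y)) ≤ s ^ 2 * (‖f y‖ ^ 2 + ‖f' y‖ ^ 2) := by gcongr
      _ ≤ y ^ 2 * (‖f y‖ ^ 2 + ‖f' y‖ ^ 2) := by gcongr
      _ = _ := by ring
  have h5 := intervalIntegral_le_of_integrableOn_Ioi (fun y => by positivity) hi hb hs.le hst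
  have h6 := intervalIntegral_le_of_integrableOn_Ioi (fun y => by positivity) hi0 hb0 hs.le hst
  have h7 : s ^ 2 * ‖f t‖ ^ 2 ≤ ε := by
    have h8 : s * ‖f t‖ ≤ √ε := by rwa [le_div_iff₀' hs] at ht
    rw [← mul_pow]
    exact (Real.le_sqrt (by positivity) hε.le).1 h8
  have h9 : s ^ 2 * ‖f s‖ ^ 2 = s ^ 2 * ‖f t‖ ^ 2
      + s ^ 2 * -(∫ y in s..t, 2 * inner ℝ (f y) (f' y)) := by
    rw [← hI]
    ring
  linarith

end Curve

/-- The area of the unit sphere in `ℝ³`. -/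
def sphereArea : ℝ := 3 * (volume : Measure R3).real (ball 0 1)

lemma sphereArea_pos : 0 < sphereArea :=
  mul_pos three_pos (ENNReal.toReal_pos (measure_ball_pos _ _ one_pos).ne' measure_ball_lt_top.ne)

lemma radial_integral_le {G : ℝ → ℝ} (hG : Continuous G) (h0 : ∀ y, 0 ≤ G y) {b : ℝ}
    (hb0 : 0 ≤ b) (hb : ∫⁻ x : R3, ENNReal.ofReal (G ‖x‖) ≤ ENNReal.ofReal b) :
    IntegrableOn (fun y => y ^ 2 * G y) (Ioi 0) ∧
      ∫ y in Ioi 0, y ^ 2 * G y ≤ b / sphereArea := by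
  have hc : Continuous fun x : R3 => G ‖x‖ := hG.comp continuous_norm
  have hint : Integrable (fun x : R3 => G ‖x‖) volume := by
    refine ⟨hc.aestronglyMeasurable, ?_⟩
    rw [hasFiniteIntegral_iff_ofReal (Eventually.of_forall fun x => h0 _)]
    exact hb.trans_lt ENNReal.ofReal_lt_top
  have hle : ∫ x : R3, G ‖x‖ ≤ b := by
    rw [← ENNReal.ofReal_le_ofReal_iff hb0,
      ofReal_integral_eq_lintegral_ofReal hint (Eventually.of_forall fun x => h0 _)]
    exact hb
  have h1 := (integrable_fun_norm_addHaar (volume : Measure R3)).1 hint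
  rw [integral_fun_norm_addHaar, finrank_euclideanSpace, Fintype.card_fin] at hle
  rw [finrank_euclideanSpace, Fintype.card_fin] at h1
  refine ⟨h1, ?_⟩
  rw [le_div_iff₀ sphereArea_pos, sphereArea]
  calc _ = 3 • (volume : Measure R3).real (ball 0 1) • ∫ y in Ioi 0, y ^ (3 - 1) • G y := by
        simp only [smul_eq_mul, nsmul_eq_mul]
        push_cast
        ring
    _ ≤ b := hle

namespace IsSmoothEquivariant

variable {m : ℕ} {D : SO3 →* Matrix.unitaryGroup (Fin m) ℂ} {a a' : ℝ} {v w : R3 → Cm m}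

lemma norm_eq (hv : IsSmoothEquivariant D a v) (x : R3) : ‖v (‖x‖ • e0)‖ = ‖v x‖ := by
  obtain ⟨R, hR⟩ := exists_rot x
  conv_rhs => rw [← hR, hv.map_rot, norm_unitary]

/-- Differentiate `v ∘ R = D(R) ∘ v` at the point of the ray: the derivative along the ray becomes a
derivative of `v` at `x` in a unit direction. -/
lemma norm_fderiv_le (hv : IsSmoothEquivariant D a v) (x : R3) :
    ‖fderiv ℝ v (‖x‖ • e0) e0‖ ≤ ‖fderiv ℝ v x‖ := by
  obtain ⟨R, hR⟩ := exists_rot x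
  set z := ‖x‖ • e0
  have hdiff := hv.contDiff.differentiable one_ne_zero
  set A := Matrix.toEuclideanCLM (𝕜 := ℂ) (D R : Matrix (Fin m) (Fin m) ℂ) with hA
  have h1 : HasFDerivAt (fun y => v (rot R y))
      ((fderiv ℝ v (rot R z)).comp (rot R).toContinuousLinearMap) z :=
    (hdiff _).hasFDerivAt.comp z (rot R).toContinuousLinearMap.hasFDerivAt
  have h2 : HasFDerivAt (fun y => A (v y)) ((A.restrictScalars ℝ).comp (fderiv ℝ v z)) z :=
    (A.restrictScalars ℝ).hasFDerivAt.comp z (hdiff z).hasFDerivAt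
  have h3 : (fun y => v (rot R y)) = fun y => A (v y) := funext (hv.map_rot R)
  rw [h3] at h1
  have h4 := congrArg (fun L : R3 →L[ℝ] Cm m => ‖L e0‖) (h1.unique h2)
  have h5 : ‖fderiv ℝ v x (rot R e0)‖ = ‖fderiv ℝ v z e0‖ := by
    have h6 : ‖A (fderiv ℝ v z e0)‖ = ‖fderiv ℝ v z e0‖ := norm_unitary _ _
    rw [← h6, ← hR]
    exact h4
  rw [← h5]
  refine (ContinuousLinearMap.le_opNorm _ _).trans_eq ?_
  rw [(rot R).norm_map, norm_e0, mul_one]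

lemma hasDerivAt_ray (hv : IsSmoothEquivariant D a v) (s : ℝ) :
    HasDerivAt (fun s : ℝ => v (s • e0)) (fderiv ℝ v (s • e0) e0) s := by
  have h1 : HasDerivAt (fun s : ℝ => s • e0) e0 s := by
    simpa using (hasDerivAt_id s).smul_const e0
  exact ((hv.contDiff.differentiable one_ne_zero) _).hasFDerivAt.comp_hasDerivAt s h1

lemma continuous_fderiv_ray (hv : IsSmoothEquivariant D a v) :
    Continuous fun s : ℝ => fderiv ℝ v (s • e0) e0 :=
  ((hv.contDiff.continuous_fderiv one_ne_zero).comp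
    (continuous_id.smul continuous_const)).clm_apply continuous_const

lemma integral_ray (hv : IsSmoothEquivariant D a v) :
    IntegrableOn (fun y => y ^ 2 * ‖v (y • e0)‖ ^ 2) (Ioi 0) ∧
      ∫ y in Ioi 0, y ^ 2 * ‖v (y • e0)‖ ^ 2 ≤ a ^ 2 / sphereArea := by
  refine radial_integral_le (G := fun y => ‖v (y • e0)‖ ^ 2) ?_ (fun y => by positivity)
    (sq_nonneg a) (le_trans (le_of_eq ?_) hv.lintegral_le)
  · exact ((hv.contDiff.continuous.comp (continuous_id.smul continuous_const)).norm).pow 2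
  · refine lintegral_congr fun x => ?_
    rw [hv.norm_eq, ENNReal.ofReal_pow (norm_nonneg _), ofReal_norm]

lemma integral_fderiv_ray (hv : IsSmoothEquivariant D a v) :
    IntegrableOn (fun y => y ^ 2 * ‖fderiv ℝ v (y • e0) e0‖ ^ 2) (Ioi 0) ∧
      ∫ y in Ioi 0, y ^ 2 * ‖fderiv ℝ v (y • e0) e0‖ ^ 2 ≤ a ^ 2 / sphereArea := by
  refine radial_integral_le (G := fun y => ‖fderiv ℝ v (y • e0) e0‖ ^ 2) ?_
    (fun y => by positivity) (sq_nonneg a) (le_trans (lintegral_mono fun x => ?_)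
      hv.lintegral_fderiv_le)
  · exact hv.continuous_fderiv_ray.norm.pow 2
  · rw [ENNReal.ofReal_pow (norm_nonneg _), ofReal_norm]
    gcongr
    exact enorm_le_iff_norm_le.2 (hv.norm_fderiv_le x)

lemma norm_le_div (hv : IsSmoothEquivariant D a v) (ha : 0 ≤ a) {x : R3} (hx : x ≠ 0) :
    ‖v x‖ ≤ √(2 / sphereArea) / ‖x‖ * a := by
  have hx' : 0 < ‖x‖ := norm_pos_iff.2 hx
  have h := sq_mul_norm_sq_le_of_weighted hv.hasDerivAt_ray hv.continuous_fderiv_ray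
    hv.integral_fderiv_ray.1 hv.integral_fderiv_ray.2 hv.integral_ray.1 hv.integral_ray.2 hx'
  rw [hv.norm_eq] at h
  have h2 : ‖x‖ * ‖v x‖ ≤ √(2 / sphereArea) * a := by
    refine le_of_sq_le_sq ?_ (by positivity)
    rw [mul_pow, mul_pow, Real.sq_sqrt (div_nonneg two_pos.le sphereArea_pos.le)]
    exact h.trans_eq (by ring)
  rw [div_mul_eq_mul_div, le_div_iff₀ hx', mul_comm]
  exact h2

lemma norm_le_inv_sqrt (hv : IsSmoothEquivariant D a v) {x : R3} (hx : x ≠ 0) :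
    ‖v x‖ ≤ (a ^ 2 / sphereArea + 1) / 2 * (√‖x‖)⁻¹ := by
  have h := norm_le_of_weighted_deriv hv.hasDerivAt_ray hv.continuous_fderiv_ray
    hv.integral_fderiv_ray.1 hv.integral_fderiv_ray.2 hv.integral_ray.1 (norm_pos_iff.2 hx)
  rwa [hv.norm_eq] at h

lemma norm_sub_ray_le (hv : IsSmoothEquivariant D a v) {s t h : ℝ} (hs : 0 < s) (hst : s ≤ t)
    (hh : 0 < h) (hle : s⁻¹ - t⁻¹ ≤ h) :
    ‖v (t • e0) - v (s • e0)‖ ≤ (a ^ 2 / sphereArea + 1) / 2 * √h := by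
  have hq := Real.sqrt_pos.2 hh
  have h1 := norm_sub_le_of_weighted_deriv hv.hasDerivAt_ray hv.continuous_fderiv_ray
    hv.integral_fderiv_ray.1 hv.integral_fderiv_ray.2 hs hst hq
  have h2 : (s⁻¹ - t⁻¹) / √h ≤ √h := by
    rw [div_le_iff₀ hq, Real.mul_self_sqrt hh.le]
    exact hle
  linarith

/-- Both functions transform by the same `D R`, so comparing them on the ray suffices. -/
lemma norm_sub_eq (hv : IsSmoothEquivariant D a v) (hw : IsSmoothEquivariant D a' w) (x : R3) :
    ‖v (‖x‖ • e0) - w (‖x‖ • e0)‖ = ‖v x - w x‖ := by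
  obtain ⟨R, hR⟩ := exists_rot x
  conv_rhs => rw [← hR, hv.map_rot, hw.map_rot, ← map_sub, norm_unitary]

end IsSmoothEquivariant

/-- The radial bound for rotation-invariant Sobolev functions. -/
lemma radial_bound {m : ℕ} {D : SO3 →* Matrix.unitaryGroup (Fin m) ℂ} (u : H1rho D) :
    ∀ᵐ x, ‖H1.toL2 m u x‖ ≤ √(2 / sphereArea) / ‖x‖ * ‖u‖ := by
  obtain ⟨v, hv, hlim⟩ := exists_smooth_approx u
  filter_upwards [hlim, Measure.ae_ne volume 0] with x hx h0
  exact le_of_tendsto' hx.norm fun n => (hv n).norm_le_div (norm_nonneg u) h0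

lemma ae_norm_le_inv_sqrt {m : ℕ} {D : SO3 →* Matrix.unitaryGroup (Fin m) ℂ} (u : H1rho D) :
    ∀ᵐ x, ‖H1.toL2 m u x‖ ≤ (‖u‖ ^ 2 / sphereArea + 1) / 2 * (√‖x‖)⁻¹ := by
  obtain ⟨v, hv, hlim⟩ := exists_smooth_approx u
  filter_upwards [hlim, Measure.ae_ne volume 0] with x hx h0
  exact le_of_tendsto' hx.norm fun n => (hv n).norm_le_inv_sqrt h0

end Radial

/-! ### The compact embedding into `Lᵖ` -/

section Embedding

open Filter Topology Metric Set

variable {m : ℕ} {D : SO3 →* Matrix.unitaryGroup (Fin m) ℂ}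

/-- In polar coordinates the integrand is `y^(2 - q/2)`, and `q < 6` makes this exponent exceed -1.
-/
lemma setLIntegral_inv_sqrt_norm_lt_top {q : ℝ} (hq : q < 6) :
    ∫⁻ x in ball (0 : R3) 1, ‖(√‖x‖)⁻¹‖ₑ ^ q < ⊤ := by
  have h1 : IntegrableOn (fun x : R3 => ‖x‖ ^ (-(q / 2))) (ball 0 1) volume := by
    rw [integrableOn_fun_norm_addHaar (volume : Measure R3) (f := fun y => y ^ (-(q / 2))),
      finrank_euclideanSpace, Fintype.card_fin]
    have h2 := intervalIntegral.intervalIntegrable_rpow' (a := 0) (b := 1) (r := 2 - q / 2)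
      (by linarith)
    rw [intervalIntegrable_iff_integrableOn_Ioo_of_le zero_le_one] at h2
    refine h2.congr_fun (fun y hy => ?_) measurableSet_Ioo
    simp only [smul_eq_mul]
    rw [sub_eq_add_neg, Real.rpow_add hy.1]
    norm_num
  refine lt_of_le_of_lt (le_of_eq ?_) h1.2
  refine lintegral_congr_ae (ae_restrict_of_ae ?_)
  filter_upwards [Measure.ae_ne volume 0] with x hx
  have hx' : 0 < ‖x‖ := norm_pos_iff.2 hx
  rw [← ofReal_norm, ← ofReal_norm, Real.norm_of_nonneg (by positivity),
    Real.norm_of_nonneg (by positivity), ENNReal.ofReal_rpow_of_pos (by positivity),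
    Real.sqrt_eq_rpow, ← Real.rpow_neg hx'.le, ← Real.rpow_mul hx'.le]
  congr 2
  ring

lemma tendsto_setLIntegral_inv_sqrt_norm {q : ℝ} (hq : q < 6) :
    Tendsto (fun r : ℝ => ∫⁻ x in ball (0 : R3) r, ‖(√‖x‖)⁻¹‖ₑ ^ q) (𝓝[>] 0) (𝓝 0) := by
  have h1 : Tendsto (fun r : ℝ => (volume.restrict (ball (0 : R3) 1)) (ball 0 r))
      (𝓝[>] 0) (𝓝 0) := by
    have hv : Tendsto (fun r : ℝ => (volume : Measure R3) (ball 0 r)) (𝓝[>] 0) (𝓝 0) := by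
      have : Tendsto (fun r : ℝ => ENNReal.ofReal (r ^ 3) * (volume : Measure R3) (ball 0 1))
          (𝓝[>] 0) (𝓝 (ENNReal.ofReal (0 ^ 3) * (volume : Measure R3) (ball 0 1))) := by
        refine ENNReal.Tendsto.mul_const (ENNReal.tendsto_ofReal ?_) (Or.inr measure_ball_lt_top.ne)
        exact ((continuous_pow 3).tendsto 0).mono_left nhdsWithin_le_nhds
      rw [show ENNReal.ofReal ((0 : ℝ) ^ 3) = 0 by simp, zero_mul] at this
      refine this.congr' ?_
      filter_upwards [self_mem_nhdsWithin] with r hr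
      rw [Measure.addHaar_ball _ _ (le_of_lt hr), finrank_euclideanSpace, Fintype.card_fin]
    exact tendsto_of_tendsto_of_tendsto_of_le_of_le tendsto_const_nhds hv (fun _ => zero_le)
      fun r => Measure.restrict_apply_le _ _
  have h2 := tendsto_setLIntegral_zero (setLIntegral_inv_sqrt_norm_lt_top hq).ne h1
  refine h2.congr' ?_
  filter_upwards [Ioo_mem_nhdsGT (zero_lt_one' ℝ)] with r hr
  rw [Measure.restrict_restrict measurableSet_ball,
    inter_eq_left.2 (ball_subset_ball hr.2.le)]

lemma lintegral_rpow_le_of_radial {q A η r : ℝ} (hq : 2 < q) {B : ℝ≥0∞} {w : R3 → Cm m}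
    (hA : ∀ᵐ x, ‖w x‖ ≤ A * (√‖x‖)⁻¹) (hη : ∀ᵐ x, r ≤ ‖x‖ → ‖w x‖ ≤ η)
    (hB : ∫⁻ x, ‖w x‖ₑ ^ 2 ≤ B) :
    ∫⁻ x, ‖w x‖ₑ ^ q ≤ ENNReal.ofReal A ^ q * (∫⁻ x in ball (0 : R3) r, ‖(√‖x‖)⁻¹‖ₑ ^ q)
      + ENNReal.ofReal η ^ (q - 2) * B := by
  have hmeas : Measurable fun x : R3 => ‖(√‖x‖)⁻¹‖ₑ ^ q := by fun_prop
  rw [← lintegral_add_compl _ (measurableSet_ball (x := (0 : R3)) (ε := r))]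
  refine add_le_add ?_ ?_
  · rw [← lintegral_const_mul _ hmeas]
    refine lintegral_mono_ae (ae_restrict_of_ae ?_)
    filter_upwards [hA] with x hx
    rw [← ENNReal.mul_rpow_of_nonneg _ _ (by linarith)]
    refine ENNReal.rpow_le_rpow ?_ (by linarith)
    rw [← ofReal_norm, ← ofReal_norm, Real.norm_of_nonneg (by positivity),
      ← ENNReal.ofReal_mul' (by positivity)]
    exact ENNReal.ofReal_le_ofReal hx
  · calc ∫⁻ x in (ball (0 : R3) r)ᶜ, ‖w x‖ₑ ^ q
        ≤ ∫⁻ x in (ball (0 : R3) r)ᶜ, ENNReal.ofReal η ^ (q - 2) * ‖w x‖ₑ ^ 2 := by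
          refine lintegral_mono_ae ?_
          filter_upwards [ae_restrict_of_ae hη, ae_restrict_mem measurableSet_ball.compl] with x hx hxr
          have h1 : ‖w x‖ₑ ≤ ENNReal.ofReal η := by
            rw [← ofReal_norm]
            exact ENNReal.ofReal_le_ofReal (hx (by simpa using hxr))
          calc ‖w x‖ₑ ^ q = ‖w x‖ₑ ^ ((q - 2) + 2) := by rw [sub_add_cancel]
            _ = ‖w x‖ₑ ^ (q - 2) * ‖w x‖ₑ ^ 2 := by
                rw [ENNReal.rpow_add_of_nonneg _ _ (by linarith) two_pos.le, ENNReal.rpow_two]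
            _ ≤ _ := by
                gcongr
      _ = ENNReal.ofReal η ^ (q - 2) * ∫⁻ x in (ball (0 : R3) r)ᶜ, ‖w x‖ₑ ^ 2 := by
          refine lintegral_const_mul' _ _ (ENNReal.rpow_ne_top_of_nonneg (by linarith) (by finiteness))
      _ ≤ _ := by
          gcongr
          exact (setLIntegral_le_lintegral _ _).trans hB

lemma norm_toL2_le (u : H1rho D) : ‖H1.toL2 m u‖ ≤ ‖u‖ :=
  WithLp.norm_fst_le _ (u : WithLp 2 (L2 m × PiLp 2 (fun _ : Fin 3 => L2 m)))

lemma lintegral_toL2_rpow_le (u : H1rho D) {q η r a : ℝ} (hq : 2 < q) (ha : ‖u‖ ≤ a)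
    (hη : ∀ᵐ x, r ≤ ‖x‖ → ‖H1.toL2 m u x‖ ≤ η) :
    ∫⁻ x, ‖H1.toL2 m u x‖ₑ ^ q ≤ ENNReal.ofReal ((a ^ 2 / sphereArea + 1) / 2) ^ q *
      (∫⁻ x in ball (0 : R3) r, ‖(√‖x‖)⁻¹‖ₑ ^ q)
      + ENNReal.ofReal η ^ (q - 2) * ENNReal.ofReal (a ^ 2) := by
  refine lintegral_rpow_le_of_radial hq ?_ hη ?_
  · filter_upwards [ae_norm_le_inv_sqrt u] with x hx
    have := sphereArea_pos
    refine hx.trans ?_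
    gcongr
  · rw [lintegral_enorm_sq_eq]
    refine ENNReal.ofReal_le_ofReal ?_
    have := (norm_toL2_le u).trans ha
    gcongr

lemma memLp_toL2 (u : H1rho D) {p : ℝ≥0∞} (hp2 : 2 < p) (hp6 : p < 6) :
    MemLp (H1.toL2 m u) p volume := by
  have hp : p ≠ ⊤ := (hp6.trans_le le_top).ne
  have hq2 : 2 < p.toReal := by simpa using (ENNReal.toReal_lt_toReal (by simp) hp).2 hp2
  have hq6 : p.toReal < 6 := by simpa using (ENNReal.toReal_lt_toReal hp (by simp)).2 hp6
  refine ⟨Lp.aestronglyMeasurable _, ?_⟩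
  rw [eLpNorm_lt_top_iff_lintegral_rpow_enorm_lt_top (by positivity) hp]
  -- Outside the unit ball `‖x‖^(-1/2) ≤ 1`, so the constant of the pointwise bound serves as `η`.
  refine (lintegral_toL2_rpow_le u (r := 1) (η := (‖u‖ ^ 2 / sphereArea + 1) / 2) hq2 le_rfl
    ?_).trans_lt ?_
  · filter_upwards [ae_norm_le_inv_sqrt u] with x hx h1
    have := sphereArea_pos
    refine hx.trans (mul_le_of_le_one_right (by positivity) ?_)
    exact inv_le_one_of_one_le₀ (Real.one_le_sqrt.2 h1)
  · refine ENNReal.add_lt_top.2 ⟨ENNReal.mul_lt_top ?_ (setLIntegral_inv_sqrt_norm_lt_top hq6),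
      ENNReal.mul_lt_top ?_ ENNReal.ofReal_lt_top⟩
    · exact ENNReal.rpow_lt_top_of_nonneg (by linarith) (by finiteness)
    · exact ENNReal.rpow_lt_top_of_nonneg (by linarith) (by finiteness)

/-- The inclusion of rotation-invariant Sobolev functions into `Lᵖ`, `2 < p < 6`. -/
def toLpₗ (D : SO3 →* Matrix.unitaryGroup (Fin m) ℂ) {p : ℝ≥0∞} [Fact (1 ≤ p)]
    (hp2 : 2 < p) (hp6 : p < 6) : H1rho D →ₗ[ℂ] Lp (Cm m) p (volume : Measure R3) where
  toFun u := (memLp_toL2 u hp2 hp6).toLp _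
  map_add' u v := by
    refine Lp.ext ?_
    filter_upwards [MemLp.coeFn_toLp (memLp_toL2 (u + v) hp2 hp6),
      MemLp.coeFn_toLp (memLp_toL2 u hp2 hp6), MemLp.coeFn_toLp (memLp_toL2 v hp2 hp6),
      Lp.coeFn_add ((memLp_toL2 u hp2 hp6).toLp _) ((memLp_toL2 v hp2 hp6).toLp _),
      Lp.coeFn_add (H1.toL2 m u) (H1.toL2 m v)] with x h1 h2 h3 h4 h5
    rw [h1, h4, Pi.add_apply, h2, h3, Submodule.coe_add, map_add, h5, Pi.add_apply]
  map_smul' c u := by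
    refine Lp.ext ?_
    filter_upwards [MemLp.coeFn_toLp (memLp_toL2 (c • u) hp2 hp6),
      MemLp.coeFn_toLp (memLp_toL2 u hp2 hp6),
      Lp.coeFn_smul c ((memLp_toL2 u hp2 hp6).toLp _),
      Lp.coeFn_smul c (H1.toL2 m u)] with x h1 h2 h3 h4
    rw [h1, RingHom.id_apply, h3, Pi.smul_apply, h2, Submodule.coe_smul, map_smul, h4,
      Pi.smul_apply]

lemma toLpₗ_ae_eq {p : ℝ≥0∞} [Fact (1 ≤ p)] (hp2 : 2 < p) (hp6 : p < 6) (u : H1rho D) :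
    toLpₗ D hp2 hp6 u =ᵐ[volume] H1.toL2 m u :=
  MemLp.coeFn_toLp (memLp_toL2 u hp2 hp6)

lemma IsWeakPartial.ae_unique {i : Fin 3} {u g g' : R3 → Cm m} (hg : LocallyIntegrable g volume)
    (hg' : LocallyIntegrable g' volume) (h : IsWeakPartial i u g) (h' : IsWeakPartial i u g') :
    g =ᵐ[volume] g' := by
  refine ae_eq_of_integral_contDiff_smul_eq hg hg' fun φ hφ hc => ?_
  have := (h φ hφ hc).symm.trans (h' φ hφ hc)
  exact neg_inj.1 this

lemma toL2_injective : Function.Injective fun u : H1rho D => H1.toL2 m u := by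
  intro u v h
  have hloc : ∀ f : L2 m, LocallyIntegrable f volume :=
    fun f => (Lp.memLp f).locallyIntegrable (by norm_num)
  refine Subtype.ext (Subtype.ext (WithLp.ofLp_injective 2 (Prod.ext h ?_)))
  refine PiLp.ext fun i => Lp.ext ?_
  have h1 := u.1.2 i
  have h2 := v.1.2 i
  have h3 : (u.1.1.fst : L2 m) = v.1.1.fst := h
  rw [h3] at h1
  exact h1.ae_unique (hloc _) (hloc _) h2

lemma toLpₗ_injective {p : ℝ≥0∞} [Fact (1 ≤ p)] (hp2 : 2 < p) (hp6 : p < 6) :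
    Function.Injective (toLpₗ D hp2 hp6) := by
  intro u v h
  refine toL2_injective (Lp.ext ?_)
  exact (toLpₗ_ae_eq hp2 hp6 u).symm.trans ((by rw [h] : _ =ᵐ[volume] _).trans
    (toLpₗ_ae_eq hp2 hp6 v))

lemma IsSmoothEquivariant.mono {a b : ℝ} {v : R3 → Cm m} (hv : IsSmoothEquivariant D a v)
    (ha : 0 ≤ a) (hab : a ≤ b) : IsSmoothEquivariant D b v :=
  have h : ENNReal.ofReal (a ^ 2) ≤ ENNReal.ofReal (b ^ 2) :=
    ENNReal.ofReal_le_ofReal (pow_le_pow_left₀ ha hab 2)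
  ⟨hv.contDiff, hv.map_rot, hv.lintegral_le.trans h, hv.lintegral_fderiv_le.trans h⟩

/-- The oscillation is controlled by differences of `1/s`, so the grid is equally spaced in that
variable. As `1/t` lies in `(0, 1/r]`, finitely many points suffice, the same for all `v`. -/
lemma IsSmoothEquivariant.exists_grid (r η a : ℝ) (hr : 0 < r) (hη : 0 < η) :
    ∃ (N : ℕ) (s : Fin N → ℝ), (∀ i, 0 < s i) ∧ ∀ t, r ≤ t → ∃ i, ∀ v : R3 → Cm m,
      IsSmoothEquivariant D a v → ‖v (t • e0) - v (s i • e0)‖ ≤ η := by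
  have hM : 0 < (a ^ 2 / sphereArea + 1) / 2 := by
    have := sphereArea_pos
    positivity
  set M := (a ^ 2 / sphereArea + 1) / 2 with hMdef
  -- Chosen so that `M * √h = η`.
  set h := (η / M) ^ 2 with hhdef
  have hh : 0 < h := by positivity
  -- The shift by one starts the grid at `1/s = h`, since `1/s = 0` would be the point at infinity.
  -- Rounding `1/t` up gives a grid point `s ≤ t`.
  refine ⟨⌈r⁻¹ / h⌉₊, fun i => (((i : ℕ) + 1 : ℝ) * h)⁻¹, fun i => by positivity, fun t ht => ?_⟩
  have ht0 : 0 < t := hr.trans_le ht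
  have hpos : 0 < ⌈t⁻¹ / h⌉₊ := Nat.ceil_pos.2 (by positivity)
  have hle : ⌈t⁻¹ / h⌉₊ ≤ ⌈r⁻¹ / h⌉₊ := Nat.ceil_mono (by gcongr)
  refine ⟨⟨⌈t⁻¹ / h⌉₊ - 1, by omega⟩, fun v hv => ?_⟩
  have hcast : ((⌈t⁻¹ / h⌉₊ - 1 : ℕ) : ℝ) + 1 = ⌈t⁻¹ / h⌉₊ := by
    rw [Nat.cast_sub hpos]
    simp
  simp only [hcast]
  have h1 : t⁻¹ ≤ ⌈t⁻¹ / h⌉₊ * h := (div_le_iff₀ hh).1 (Nat.le_ceil _)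
  have h2 : (⌈t⁻¹ / h⌉₊ : ℝ) * h ≤ t⁻¹ + h := by
    have := (Nat.ceil_lt_add_one (a := t⁻¹ / h) (by positivity)).le
    calc (⌈t⁻¹ / h⌉₊ : ℝ) * h ≤ (t⁻¹ / h + 1) * h := by gcongr
      _ = _ := by field_simp
  have h0 : (0 : ℝ) < ⌈t⁻¹ / h⌉₊ * h := lt_of_lt_of_le (by positivity) h1
  have h3 := hv.norm_sub_ray_le (inv_pos.2 h0) (t := t)
    (inv_le_of_inv_le₀ ht0 h1) hh (by rw [inv_inv]; linarith)
  refine h3.trans_eq ?_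
  rw [hhdef, Real.sqrt_sq (by positivity), ← hMdef]
  field_simp

/-- The label of `v` records, at each grid point, a nearby element of a finite net in a ball of
`ℂᵐ`. Equal labels leave four errors of `η / 4`: two from the grid, two from the net. -/
lemma IsSmoothEquivariant.exists_finite_discretization (D : SO3 →* Matrix.unitaryGroup (Fin m) ℂ)
    (r η a : ℝ) (hr : 0 < r) (hη : 0 < η) :
    ∃ (β : Type) (_ : Fintype β) (F : {v : R3 → Cm m // IsSmoothEquivariant D a v} → β),
      ∀ v w, F v = F w → ∀ x, r ≤ ‖x‖ → ‖v.1 x - w.1 x‖ ≤ η := by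
  obtain ⟨N, s, hs, hgrid⟩ :=
    IsSmoothEquivariant.exists_grid (D := D) r (η / 4) a hr (by positivity)
  have hb : ∀ i, ∃ T : Set (Cm m), T.Finite ∧ ∀ v : R3 → Cm m, IsSmoothEquivariant D a v →
      ∃ y ∈ T, dist (v (s i • e0)) y < η / 4 := by
    intro i
    obtain ⟨T, hT, hcov⟩ := Metric.totallyBounded_iff.1 (isCompact_closedBall (0 : Cm m)
      ((a ^ 2 / sphereArea + 1) / 2 * (√‖s i • e0‖)⁻¹)).totallyBounded (η / 4) (by positivity)
    refine ⟨T, hT, fun v hv => ?_⟩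
    have hne : s i • e0 ≠ 0 := by
      rw [← norm_pos_iff, norm_smul, norm_e0, mul_one]
      exact norm_pos_iff.2 (hs i).ne'
    have := hcov (mem_closedBall_zero_iff.2 (hv.norm_le_inv_sqrt hne))
    simpa using this
  choose T hT hTv using hb
  have : ∀ i, Finite (T i) := fun i => (hT i).to_subtype
  choose y hyT hy using hTv
  refine ⟨∀ i, T i, Fintype.ofFinite _, fun v i => ⟨y i v.1 v.2, hyT i v.1 v.2⟩,
    fun v w hvw x hx => ?_⟩
  obtain ⟨i, hi⟩ := hgrid ‖x‖ hx
  have h1 := hi v.1 v.2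
  have h2 := hi w.1 w.2
  have h3 := hy i v.1 v.2
  have h4 := hy i w.1 w.2
  have h5 : y i v.1 v.2 = y i w.1 w.2 := congrArg Subtype.val (congrFun hvw i)
  rw [← h5] at h4
  rw [← v.2.norm_sub_eq w.2]
  rw [← dist_eq_norm] at h1 h2 ⊢
  have h6 := dist_triangle4 (v.1 (‖x‖ • e0)) (v.1 (s i • e0)) (w.1 (s i • e0)) (w.1 (‖x‖ • e0))
  have h7 := dist_triangle_right (v.1 (s i • e0)) (w.1 (s i • e0)) (y i v.1 v.2)
  rw [dist_comm (w.1 (s i • e0)) (w.1 _)] at h6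
  linarith

lemma exists_finite_discretization (D : SO3 →* Matrix.unitaryGroup (Fin m) ℂ) {r η : ℝ}
    (a : ℝ) (hr : 0 < r) (hη : 0 < η) :
    ∃ (β : Type) (_ : Fintype β) (F : {u : H1rho D // ‖u‖ ≤ a} → β),
      ∀ u v, F u = F v → ∀ᵐ x, r ≤ ‖x‖ → ‖H1.toL2 m u x - H1.toL2 m v x‖ ≤ η := by
  obtain ⟨β, hβ, F, hF⟩ := IsSmoothEquivariant.exists_finite_discretization D r η a hr hη
  choose φ hφ hlim using exists_smooth_approx (D := D)
  let ψ : ∀ (u : {u : H1rho D // ‖u‖ ≤ a}), ℕ → {v : R3 → Cm m // IsSmoothEquivariant D a v} :=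
    fun u n => ⟨φ u n, (hφ u n).mono (norm_nonneg _) u.2⟩
  -- There are finitely many labels, so some label recurs infinitely often along the approximating
  -- sequence; it becomes the label of the limit.
  have hfreq : ∀ u : {u : H1rho D // ‖u‖ ≤ a}, ∃ b, ∃ᶠ n in atTop, F (ψ u n) = b := by
    intro u
    by_contra! hcon
    have h1 : ∀ᶠ n in atTop, ∀ b, F (ψ u n) ≠ b :=
      eventually_all.2 hcon
    obtain ⟨n, hn⟩ := h1.exists
    exact hn _ rfl
  choose G hG using hfreq
  refine ⟨β, hβ, G, fun u v huv => ?_⟩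
  filter_upwards [hlim u, hlim v] with x hu hv hx
  -- The limits are taken one at a time: first in the approximants of `v`, then in those of `u`,
  -- each along its recurring label.
  have key : ∀ n, F (ψ u n) = G u → ‖φ u n x - H1.toL2 m v x‖ ≤ η := by
    intro n hn
    refine isClosed_Iic.mem_of_frequently_of_tendsto ?_ (hv.const_sub (φ u n x)).norm
    refine (hG v).mono fun k hk => ?_
    exact hF (ψ u n) (ψ v k) (hn.trans (huv.trans hk.symm)) x hx
  exact isClosed_Iic.mem_of_frequently_of_tendsto ((hG u).mono key) (hu.sub_const _).norm

lemma isCompactOperator_toLpₗ {p : ℝ≥0∞} [Fact (1 ≤ p)] (hp2 : 2 < p) (hp6 : p < 6) :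
    IsCompactOperator (toLpₗ D hp2 hp6) := by
  have hp : p ≠ ⊤ := (hp6.trans_le le_top).ne
  have hq2 : 2 < p.toReal := by simpa using (ENNReal.toReal_lt_toReal (by simp) hp).2 hp2
  have hq6 : p.toReal < 6 := by simpa using (ENNReal.toReal_lt_toReal hp (by simp)).2 hp6
  set q := p.toReal with hq
  rw [isCompactOperator_iff_exists_mem_nhds_isCompact_closure_image]
  refine ⟨closedBall 0 1, closedBall_mem_nhds _ one_pos, ?_⟩
  refine isCompact_iff_totallyBounded_isComplete.2
    ⟨TotallyBounded.closure ?_, isClosed_closure.isComplete⟩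
  refine Metric.totallyBounded_of_finite_discretization fun ε hε => ?_
  -- The 2 bounds the norm of a difference of two elements of the unit ball.
  set A := ENNReal.ofReal (((2 : ℝ) ^ 2 / sphereArea + 1) / 2) ^ q with hAdef
  have hA : A ≠ ⊤ := ENNReal.rpow_ne_top_of_nonneg (by linarith) (by finiteness)
  have hε' : 0 < ENNReal.ofReal ε ^ q / 2 :=
    ENNReal.half_pos (ENNReal.rpow_pos (ENNReal.ofReal_pos.2 hε) (by finiteness)).ne'
  have hr : ∃ r : ℝ, 0 < r ∧
      A * (∫⁻ x in ball (0 : R3) r, ‖(√‖x‖)⁻¹‖ₑ ^ q) < ENNReal.ofReal ε ^ q / 2 := by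
    have h1 := ENNReal.Tendsto.const_mul (tendsto_setLIntegral_inv_sqrt_norm hq6)
      (Or.inr hA)
    rw [mul_zero] at h1
    obtain ⟨r, h2, h3⟩ := ((h1.eventually_lt_const hε').and self_mem_nhdsWithin).exists
    exact ⟨r, h3, h2⟩
  have hη : ∃ η : ℝ, 0 < η ∧
      ENNReal.ofReal η ^ (q - 2) * ENNReal.ofReal (2 ^ 2) < ENNReal.ofReal ε ^ q / 2 := by
    have h0 : Tendsto (fun η : ℝ => ENNReal.ofReal η ^ (q - 2)) (𝓝[>] 0) (𝓝 0) := by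
      have h1 : Tendsto (fun η : ℝ => ENNReal.ofReal η ^ (q - 2)) (𝓝 0)
          (𝓝 (ENNReal.ofReal 0 ^ (q - 2))) :=
        ((ENNReal.continuous_rpow_const.comp ENNReal.continuous_ofReal).tendsto 0)
      rw [ENNReal.ofReal_zero, ENNReal.zero_rpow_of_pos (by linarith)] at h1
      exact h1.mono_left nhdsWithin_le_nhds
    have h1 := ENNReal.Tendsto.mul_const (b := ENNReal.ofReal (2 ^ 2)) h0 (Or.inr (by finiteness))
    rw [zero_mul] at h1
    obtain ⟨η, h2, h3⟩ := ((h1.eventually_lt_const hε').and self_mem_nhdsWithin).exists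
    exact ⟨η, h3, h2⟩
  obtain ⟨r, hr, hrε⟩ := hr
  obtain ⟨η, hη, hηε⟩ := hη
  obtain ⟨β, hβ, F, hF⟩ := exists_finite_discretization D 1 hr hη
  have hpre : ∀ y : toLpₗ D hp2 hp6 '' closedBall 0 1,
      ∃ u : {u : H1rho D // ‖u‖ ≤ 1}, toLpₗ D hp2 hp6 u = y := by
    rintro ⟨_, u, hu, rfl⟩
    exact ⟨⟨u, mem_closedBall_zero_iff.1 hu⟩, rfl⟩
  choose g hg using hpre
  -- Equal labels make the difference at most `η` outside radius `r`, so the inner and outer parts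
  -- each contribute less than `ε^q / 2`.
  refine ⟨β, hβ, fun y => F (g y), fun y z hyz => ?_⟩
  have hw : ‖((g y : H1rho D) - (g z : H1rho D))‖ ≤ 2 :=
    (norm_sub_le _ _).trans ((add_le_add (g y).2 (g z).2).trans_eq one_add_one_eq_two)
  have hsub : ∀ᵐ x, r ≤ ‖x‖ →
      ‖H1.toL2 m ((g y : H1rho D) - (g z : H1rho D) : H1rho D) x‖ ≤ η := by
    filter_upwards [hF _ _ hyz, Lp.coeFn_sub (H1.toL2 m (g y : H1rho D)) (H1.toL2 m (g z : H1rho D))]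
      with x hx h1 hrx
    rw [Submodule.coe_sub, map_sub, h1]
    exact hx hrx
  have hlt := (lintegral_toL2_rpow_le _ hq2 hw hsub).trans_lt (ENNReal.add_lt_add hrε hηε)
  rw [ENNReal.add_halves] at hlt
  rw [← hg y, ← hg z, dist_eq_norm, ← map_sub]
  change ‖(memLp_toL2 _ hp2 hp6).toLp _‖ < ε
  rw [Lp.norm_toLp]
  refine ENNReal.toReal_lt_of_lt_ofReal ?_
  rw [eLpNorm_eq_lintegral_rpow_enorm_toReal (by positivity) hp]
  rw [one_div, ENNReal.rpow_inv_lt_iff (by linarith)]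
  exact hlt

end Embedding

end RotSobolev

end

theorem lemma3p4 (m : ℕ)
    (D : RotSobolev.SO3 →* Matrix.unitaryGroup (Fin m) ℂ) :
    -- the radial bound
    (∃ C : ℝ, 0 < C ∧ ∀ u : RotSobolev.H1rho D, ∀ᵐ x : RotSobolev.R3,
      ‖RotSobolev.H1.toL2 m u x‖ ≤ C / ‖x‖ * ‖u‖) ∧
    -- the compact embedding
    (∀ (p : ℝ≥0∞) [Fact (1 ≤ p)], 2 < p → p < 6 →
      ∃ ι : RotSobolev.H1rho D →L[ℂ] Lp (RotSobolev.Cm m) p (volume : Measure RotSobolev.R3),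
        (∀ u : RotSobolev.H1rho D, ι u =ᵐ[volume] RotSobolev.H1.toL2 m u) ∧
        Function.Injective ι ∧ IsCompactOperator ι) := by
  refine ⟨⟨√(2 / RotSobolev.sphereArea),
    Real.sqrt_pos.2 (div_pos two_pos RotSobolev.sphereArea_pos), RotSobolev.radial_bound⟩, ?_⟩
  intro p _ hp2 hp6
  have hc := RotSobolev.isCompactOperator_toLpₗ (D := D) hp2 hp6
  -- Continuity comes from compactness: a compact linear map is bounded.
  exact ⟨⟨RotSobolev.toLpₗ D hp2 hp6, hc.continuous⟩, RotSobolev.toLpₗ_ae_eq hp2 hp6,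
    RotSobolev.toLpₗ_injective hp2 hp6, hc⟩
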